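/- Let $\ell,n\ge 0$ and $m\ge 1$ be integers, let $\mathbb S^n$ be the space of real symmetric $n\times n$ matrices, let $A\in\mathbb R^{\ell\times n}$, and let $\mathcal V\subset\mathbb S^n$ be nonempty, closed and convex. All matrix spaces carry the trace inner product $\langle X,Y\rangle=\mathrm{tr}(X^TY)$, and a product of two such spaces carries the sum of the two inner products. Write $\sigma_S(x)=\sup_{v\in S}\langle v,x\rangle$ for the support function of a set $S$, $\delta_S$ for its indicator function ($0$ on $S$, $+\infty$ off $S$; $\delta_\emptyset\equiv+\infty$), $\gamma_S(x)=\inf\{t\ge 0 : x\in tS\}$ (with $\inf\emptyset=+\infty$) for its gauge, $S^\circ=\{v:\langle v,x\rangle\le 1\ \forall x\in S\}$ for its polar, $S^\infty=\{v:\exists\,\lambda_k\downarrow 0,\ x_k\in S,\ \lambda_kx_k\to v\}$ for its horizon cone, $\mathrm{dom}\,f=\{x: f(x)<+\infty\}$, $\mathrm{bar}\,\mathcal V=\mathrm{dom}\,\sigma_{\mathcal V}$, and $f^*(y)=\sup_x\{\langle x,y\rangle-f(x)\}$ for the conjugate of an extended-real-valued function $f$. Put $$\mathcal K_A=\{V\in\mathbb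 S^n : u^TVu\ge 0\ \text{for all } u\in\ker A\},$$ $$\varphi=\sigma_{\mathcal D(A,0)},\qquad \mathcal D(A,0)=\{(Y,-\tfrac12YY^T) : Y\in\mathbb R^{n\times m},\ AY=0\}\subset\mathbb R^{n\times m}\times\mathbb S^n,$$ $$p:\mathbb R^{n\times m}\to\mathbb R\cup\{\pm\infty\},\qquad p(X)=\inf_{V\in\mathbb S^n}\{\varphi(X,V)+\sigma_{\mathcal V}(V)\},$$ $$\Xi(A,0)=\{Y\in\mathbb R^{n\times m} : AY=0,\ \tfrac12YY^T\in\mathrm{dom}\,\sigma_{\mathcal V}^*+\mathcal K_A^\circ\}.$$ Suppose that at least one of the following (equivalent) conditions holds: - (CCQ) $\mathrm{ri}(\mathrm{dom}\,\sigma_{\mathcal V})\cap\mathrm{int}\,\mathcal K_A\neq\emptyset$; - $\mathrm{bar}\,\mathcal V\cap\mathrm{int}\,\mathcal K_A\neq\emptyset$; - $\mathcal V^\infty\cap(-\mathcal K_A^\circ)=\{0\}$; - $\mathrm{cl}(\mathrm{bar}\,\mathcal V)-\mathcal K_A=\mathbb S^n$. Then the following hold. (a) $p^*=\delta_{\Xi(A,0)}$,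 and $$\Xi(A,0)=\{Y\in\mathbb R^{n\times m} : AY=0,\ \exists W\in\mathcal V:\ AW=0,\ \tfrac12YY^T\preceq W\},$$ where $\preceq$ is the Loewner order. (b) If in addition $0\in\mathcal V$ and $\gamma_{\mathcal V}$ is compatible with the ordering induced by the cone $K=-\mathcal K_A^\circ$ (that is, $\gamma_{\mathcal V}(x)\le\gamma_{\mathcal V}(y)$ whenever $x\in K$ and $y-x\in K$), then for every $Y\in\mathbb R^{n\times m}$ $$p^*(Y)=\delta_{\{Z\,:\,AZ=0,\ \gamma_{\mathcal V}(\frac12ZZ^T)\le 1\}}(Y)=\delta_{(-\mathcal K_A^\circ)\cap\mathcal V}\big(\tfrac12YY^T\big).$$ -/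

import Mathlib

open Set Filter Topology
open scoped Matrix Pointwise

noncomputable section

namespace GMF

/-! Convex analysis on a real space `E` with a given pairing `ip` (a Euclidean inner product in
all uses below), for extended-real-valued functions. -/

section ConvexAnalysis

variable {E : Type*}

/-- Effective domain `{x | f x < +∞}`. -/
def dom (f : E → EReal) : Set E := {x | f x < ⊤}

/-- Fenchel conjugate `f* y = sup_x (⟨x, y⟩ - f x)`. -/
def conj (ip : E → E → ℝ) (f : E → EReal) (y : E) : EReal :=
  ⨆ x : E, ((ip x y : ℝ) : EReal) - f x

/-- Support function `σ_S x = sup_{v ∈ S} ⟨v, x⟩`. -/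
def supp (ip : E → E → ℝ) (S : Set E) (x : E) : EReal :=
  ⨆ v ∈ S, ((ip v x : ℝ) : EReal)

open Classical in
/-- Indicator function `δ_S`: `0` on `S` and `+∞` elsewhere. -/
def indic (S : Set E) (x : E) : EReal := if x ∈ S then 0 else ⊤

/-- Polar set `S° = {v | ⟨v, x⟩ ≤ 1 for all x ∈ S}`. -/
def polarSet (ip : E → E → ℝ) (S : Set E) : Set E := {v | ∀ x ∈ S, ip v x ≤ 1}

/-- Gauge `γ_S x = inf {t ≥ 0 | x ∈ t S}`, with `inf ∅ = +∞`. -/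
def gaugeFn [SMul ℝ E] (S : Set E) (x : E) : EReal :=
  ⨅ (t : ℝ) (_ : 0 ≤ t ∧ x ∈ t • S), (t : EReal)

/-- Horizon cone `S^∞`: limits of `λ_k x_k` with `x_k ∈ S`, `λ_k > 0` and `λ_k → 0`. -/
def horizonCone [SMul ℝ E] [TopologicalSpace E] (S : Set E) : Set E :=
  {v | ∃ (c : ℕ → ℝ) (x : ℕ → E), (∀ k, 0 < c k) ∧ Tendsto c atTop (𝓝 0) ∧
    (∀ k, x k ∈ S) ∧ Tendsto (fun k => c k • x k) atTop (𝓝 v)}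

/-- The ordering induced by a cone `K`: `x ⪯_K y` iff `y - x ∈ K`. -/
def ConeLE [Sub E] (K : Set E) (x y : E) : Prop := y - x ∈ K

/-- `g` is compatible with the ordering induced by `K`:
`g x ≤ g y` whenever `0 ⪯_K x ⪯_K y`. -/
def ConeCompatible [Sub E] [Zero E] (K : Set E) (g : E → EReal) : Prop :=
  ∀ x y : E, ConeLE K 0 x → ConeLE K x y → g x ≤ g y

end ConvexAnalysis

/-! The matrix spaces. -/

/-- The space `𝕊ⁿ` of real symmetric `n × n` matrices. -/
def symSubmodule (n : ℕ) : Submodule ℝ (Matrix (Fin n) (Fin n) ℝ) where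
  carrier := {M | M.IsSymm}
  add_mem' := fun ha hb => Matrix.IsSymm.add ha hb
  zero_mem' := Matrix.isSymm_zero
  smul_mem' := fun c _ hM => Matrix.IsSymm.smul hM c

/-- The space `𝕊ⁿ` as a type; it carries the subspace topology. -/
abbrev SymMat (n : ℕ) : Type := symSubmodule n

/-- Trace inner product `tr (Xᵀ Y)` on `ℝ^{n × m}`. -/
def ipMat {n m : ℕ} (X Y : Matrix (Fin n) (Fin m) ℝ) : ℝ := (Xᵀ * Y).trace

/-- Trace inner product on `𝕊ⁿ`. -/
def ipSym {n : ℕ} (V W : SymMat n) : ℝ :=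
  ipMat (V : Matrix (Fin n) (Fin n) ℝ) (W : Matrix (Fin n) (Fin n) ℝ)

/-- Inner product on `ℝ^{n × m} × 𝕊ⁿ`. -/
def ipProd {n m : ℕ} (P Q : Matrix (Fin n) (Fin m) ℝ × SymMat n) : ℝ :=
  ipMat P.1 Q.1 + ipSym P.2 Q.2

/-- `½ Y Yᵀ` as an element of `𝕊ⁿ`. -/
def halfGram {n m : ℕ} (Y : Matrix (Fin n) (Fin m) ℝ) : SymMat n :=
  ⟨(1 / 2 : ℝ) • (Y * Yᵀ), by
    change ((1 / 2 : ℝ) • (Y * Yᵀ))ᵀ = _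
    rw [Matrix.transpose_smul, Matrix.transpose_mul, Matrix.transpose_transpose]⟩

/-! The generalized matrix-fractional function and its infimal projections. -/

/-- `D(A,B) = {(Y, -½ Y Yᵀ) | A Y = B}`. -/
def graphD {l n m : ℕ} (A : Matrix (Fin l) (Fin n) ℝ) (B : Matrix (Fin l) (Fin m) ℝ) :
    Set (Matrix (Fin n) (Fin m) ℝ × SymMat n) :=
  {P | A * P.1 = B ∧ P.2 = -halfGram P.1}

/-- The generalized matrix-fractional function `φ = σ_{D(A,B)}`. -/
def phi {l n m : ℕ} (A : Matrix (Fin l) (Fin n) ℝ) (B : Matrix (Fin l) (Fin m) ℝ) :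
    Matrix (Fin n) (Fin m) ℝ × SymMat n → EReal :=
  supp ipProd (graphD A B)

/-- The infimal projection `p X = inf_{V ∈ 𝕊ⁿ} (φ(X,V) + h V)`. -/
def infProj {l n m : ℕ} (A : Matrix (Fin l) (Fin n) ℝ) (B : Matrix (Fin l) (Fin m) ℝ)
    (h : SymMat n → EReal) (X : Matrix (Fin n) (Fin m) ℝ) : EReal :=
  ⨅ V : SymMat n, phi A B (X, V) + h V

/-- `K_A`: the symmetric matrices that are positive semidefinite on `ker A`. -/
def coneK {l n : ℕ} (A : Matrix (Fin l) (Fin n) ℝ) : Set (SymMat n) :=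
  {V | ∀ u : Fin n → ℝ, A *ᵥ u = 0 → 0 ≤ u ⬝ᵥ ((V : Matrix (Fin n) (Fin n) ℝ) *ᵥ u)}

/-- The conjugate constraint qualification `ri (dom h) ∩ int K_A ≠ ∅`. -/
def CCQ {l n : ℕ} (A : Matrix (Fin l) (Fin n) ℝ) (h : SymMat n → EReal) : Prop :=
  (intrinsicInterior ℝ (dom h) ∩ interior (coneK A)).Nonempty

/-- `Ξ(A,B) = {Y | A Y = B, ½ Y Yᵀ ∈ dom h* + K_A°}`. -/
def Xi {l n m : ℕ} (A : Matrix (Fin l) (Fin n) ℝ) (B : Matrix (Fin l) (Fin m) ℝ)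
    (h : SymMat n → EReal) : Set (Matrix (Fin n) (Fin m) ℝ) :=
  {Y | A * Y = B ∧ halfGram Y ∈ dom (conj ipSym h) + polarSet ipSym (coneK A)}

/-- Barrier cone `bar C = dom σ_C` of a subset of `𝕊ⁿ`. -/
def bar {n : ℕ} (C : Set (SymMat n)) : Set (SymMat n) := dom (supp ipSym C)

end GMF

end

/-! Everything is computed by testing the suprema and infima at well-chosen points. Since `p 0 ≤ 0`,
always `p* ≥ 0`. If `A Y = 0` and `½ Y Yᵀ = W + P` with `W ∈ C`, `P ∈ K_A°`, then testing `φ` at `Y`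
and `σ_C` at `W` gives `p X ≥ ⟨X, Y⟩` for all `X`, so `p* Y = 0` (`conj_infProj_nonpos`). If `A Y ≠
0`, multiples of `Aᵀ A Y` drive `p* Y` to `+∞`. If `A Y = 0` but `½ Y Yᵀ ∉ C + K_A°`, a separating
`V` lies in `K_A`, and the pairs `(t V Y, t V)` do the same (`conj_infProj_eq_top_of_notMem`).
Separation needs `C + K_A°` closed, and only there do the constraint qualifications enter: each
forces `C^∞ ∩ (-K_A°) ⊆ {0}`, which excludes escape to infinity. The explicit forms follow from
`-K_A°` being the positive semidefinite `W` with `A W = 0`. -/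

namespace GMF

/-! ### Closedness of a Minkowski sum under a horizon condition -/

section Closedness

variable {E : Type*} [NormedAddCommGroup E] [NormedSpace ℝ E]

/-- If the horizon cone of a closed set meets a closed cone `K` only at the origin, then the
difference of the set and `K` is closed. -/
theorem isClosed_sub_of_horizonCone_inter [FiniteDimensional ℝ E] {C K : Set E}
    (hC : IsClosed C) (hK : IsClosed K)
    (hcone : ∀ c : ℝ, 0 < c → ∀ x ∈ K, c • x ∈ K)
    (hCK : horizonCone C ∩ K ⊆ {0}) : IsClosed (C - K) := by
  have : ProperSpace E := FiniteDimensional.proper ℝ E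
  refine isClosed_of_closure_subset fun z hz => ?_
  obtain ⟨d, hd, hdz⟩ := mem_closure_iff_seq_limit.1 hz
  choose w hw k hk hwk using fun i => Set.mem_sub.1 (hd i)
  have hkw : ∀ i, k i = w i - d i := fun i => by rw [← hwk i]; abel
  by_cases hfreq : ∃ R : ℝ, ∃ᶠ i in atTop, ‖w i‖ ≤ R
  · obtain ⟨R, hR⟩ := hfreq
    obtain ⟨a, -, φ, hφ, ha⟩ := tendsto_subseq_of_frequently_bounded
      (Metric.isBounded_closedBall (x := (0 : E)) (r := R)) (x := w)
      (hR.mono fun i hi => by simpa using hi)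
    have hdφ := hdz.comp hφ.tendsto_atTop
    have hkφ : Tendsto (fun i => k (φ i)) atTop (𝓝 (a - z)) :=
      (ha.sub hdφ).congr fun i => (hkw (φ i)).symm
    exact Set.mem_sub.2 ⟨a, hC.mem_of_tendsto ha (Eventually.of_forall fun i => hw _),
      a - z, hK.mem_of_tendsto hkφ (Eventually.of_forall fun i => hk _), by abel⟩
  -- Here `w` escapes to infinity. Normalised, it accumulates at a unit vector `a` of the horizon
  -- cone; as `d` converges, the equally scaled `k` has the same limit, so `a ∈ K` as well.
  · exfalso
    have hinf : Tendsto (fun i => ‖w i‖) atTop atTop := by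
      refine tendsto_atTop.2 fun R => ?_
      have h := mt (fun h => (⟨R, h⟩ : ∃ R : ℝ, ∃ᶠ i in atTop, ‖w i‖ ≤ R)) hfreq
      rw [not_frequently] at h
      exact h.mono fun i hi => (not_le.1 hi).le
    -- The shift by `N` is needed because `horizonCone` asks for positive scalars at every index.
    obtain ⟨N, hN⟩ := eventually_atTop.1 (hinf.eventually_gt_atTop 0)
    have hpos : ∀ i, 0 < ‖w (i + N)‖ := fun i => hN _ (by omega)
    have hinf' := hinf.comp (tendsto_add_atTop_nat N)
    have hc0 : Tendsto (fun i => ‖w (i + N)‖⁻¹) atTop (𝓝 0) := tendsto_inv_atTop_zero.comp hinf'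
    obtain ⟨a, ha, φ, hφ, hlim⟩ := (isCompact_sphere (0 : E) 1).tendsto_subseq
      (x := fun i => ‖w (i + N)‖⁻¹ • w (i + N)) fun i => by
        rw [mem_sphere_zero_iff_norm, norm_smul, norm_inv, norm_norm,
          inv_mul_cancel₀ (hpos i).ne']
    have hcφ := hc0.comp hφ.tendsto_atTop
    have hdφ := (hdz.comp (tendsto_add_atTop_nat N)).comp hφ.tendsto_atTop
    have haK : a ∈ K := by
      have h := hlim.sub (hcφ.smul hdφ)
      rw [zero_smul, sub_zero] at h
      refine hK.mem_of_tendsto h (Eventually.of_forall fun i => ?_)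
      have := hcone _ (inv_pos.2 (hpos (φ i))) _ (hk (φ i + N))
      rw [hkw, smul_sub] at this
      exact this
    have haC : a ∈ horizonCone C :=
      ⟨_, _, fun i => inv_pos.2 (hpos (φ i)), hcφ, fun i => hw _, hlim⟩
    have h0 : a = 0 := hCK ⟨haC, haK⟩
    rw [h0] at ha
    simp at ha

/-- For a closed convex set containing the origin, the gauge is at most one exactly on the set. -/
theorem gaugeFn_le_one_iff {C : Set E} (hC : IsClosed C) (hconv : Convex ℝ C) (h0 : (0 : E) ∈ C)
    (x : E) : gaugeFn C x ≤ 1 ↔ x ∈ C := by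
  constructor
  · intro h
    -- The infimum is not known to be attained, so `x` is first shrunk into `C`; closedness then
    -- lets `ε → 0`.
    have key : ∀ ε : ℝ, 0 < ε → (1 + ε)⁻¹ • x ∈ C := by
      intro ε hε
      have hlt : gaugeFn C x < ((1 + ε : ℝ) : EReal) :=
        h.trans_lt (by exact_mod_cast (by linarith : (1 : ℝ) < 1 + ε))
      simp only [gaugeFn, iInf_lt_iff] at hlt
      obtain ⟨t, ⟨ht0, c, hc, rfl⟩, hlt⟩ := hlt
      have hlt' : t < 1 + ε := by exact_mod_cast hlt
      change (1 + ε)⁻¹ • t • c ∈ C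
      rw [smul_smul]
      have hpos : (0 : ℝ) < 1 + ε := by linarith
      refine hconv.smul_mem_of_zero_mem h0 hc ⟨by positivity, ?_⟩
      rw [inv_mul_le_iff₀ hpos]
      linarith
    have hlim : Tendsto (fun ε : ℝ => (1 + ε)⁻¹ • x) (𝓝[>] 0) (𝓝 x) := by
      have hcont : ContinuousAt (fun ε : ℝ => (1 + ε)⁻¹ • x) 0 :=
        ((continuousAt_const.add continuousAt_id).inv₀ (by norm_num)).smul continuousAt_const
      have := hcont.tendsto.mono_left (nhdsWithin_le_nhds (s := Ioi (0 : ℝ)))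
      simpa using this
    exact hC.mem_of_tendsto hlim (eventually_mem_nhdsWithin.mono key)
  · intro hx
    refine iInf₂_le_of_le 1 ⟨zero_le_one, ?_⟩ (by norm_num)
    rwa [one_smul]

end Closedness

/-! ### Extended-real-valued bounds -/

section Bounds

variable {E : Type*} {ip : E → E → ℝ}

/-- Bounding `f x` above by a real keeps the difference away from `⊤ - ⊤`. -/
theorem conj_eq_top {f : E → EReal} {y : E}
    (h : ∀ r : ℝ, ∃ x, f x ≤ ((ip x y - r : ℝ) : EReal)) : conj ip f y = ⊤ := by
  refine EReal.eq_top_iff_forall_lt _ |>.2 fun r => ?_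
  obtain ⟨x, hx⟩ := h (r + 1)
  refine lt_of_lt_of_le (b := ((r + 1 : ℝ) : EReal)) (by exact_mod_cast lt_add_one r) ?_
  refine le_trans ?_ (le_iSup (fun x => ((ip x y : ℝ) : EReal) - f x) x)
  refine le_trans ?_ (EReal.sub_le_sub le_rfl hx)
  rw [← EReal.coe_sub]
  exact_mod_cast (by linarith : r + 1 ≤ ip x y - (ip x y - (r + 1)))

theorem conj_nonpos {f : E → EReal} {y : E} (h : ∀ x, ((ip x y : ℝ) : EReal) ≤ f x) :
    conj ip f y ≤ 0 :=
  iSup_le fun x => EReal.sub_nonpos.2 (h x)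

theorem le_supp {S : Set E} {v x : E} (hv : v ∈ S) : ((ip v x : ℝ) : EReal) ≤ supp ip S x :=
  le_iSup₂ (f := fun v (_ : v ∈ S) => ((ip v x : ℝ) : EReal)) v hv

theorem supp_le_coe {S : Set E} {x : E} {s : ℝ} (h : ∀ v ∈ S, ip v x ≤ s) :
    supp ip S x ≤ (s : EReal) :=
  iSup₂_le fun v hv => by exact_mod_cast h v hv

theorem supp_lt_top_iff {S : Set E} {x : E} :
    supp ip S x < ⊤ ↔ ∃ s : ℝ, ∀ v ∈ S, ip v x ≤ s := by
  constructor
  · intro h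
    obtain ⟨s, hs, -⟩ := EReal.lt_iff_exists_real_btwn.1 h
    exact ⟨s, fun v hv => by exact_mod_cast (le_supp hv).trans hs.le⟩
  · rintro ⟨s, hs⟩
    exact (supp_le_coe hs).trans_lt (EReal.coe_lt_top s)

theorem indic_congr {F : Type*} {S : Set E} {T : Set F} {x : E} {y : F} (h : x ∈ S ↔ y ∈ T) :
    indic S x = indic T y := by
  by_cases hx : x ∈ S
  · rw [indic, indic, if_pos hx, if_pos (h.1 hx)]
  · rw [indic, indic, if_neg hx, if_neg (mt h.2 hx)]

end Bounds

/-! ### The trace inner products -/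

section InnerProducts

variable {l n m : ℕ}

theorem ipMat_comm (X Y : Matrix (Fin n) (Fin m) ℝ) : ipMat X Y = ipMat Y X := by
  rw [ipMat, ← Matrix.trace_transpose, Matrix.transpose_mul, Matrix.transpose_transpose, ipMat]

theorem ipMat_add_left (X Y Z : Matrix (Fin n) (Fin m) ℝ) :
    ipMat (X + Y) Z = ipMat X Z + ipMat Y Z := by
  simp [ipMat, Matrix.add_mul]

theorem ipMat_smul_left (c : ℝ) (X Z : Matrix (Fin n) (Fin m) ℝ) :
    ipMat (c • X) Z = c * ipMat X Z := by
  simp [ipMat]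

theorem ipMat_add_right (X Y Z : Matrix (Fin n) (Fin m) ℝ) :
    ipMat X (Y + Z) = ipMat X Y + ipMat X Z := by
  simp [ipMat, Matrix.mul_add]

theorem ipMat_smul_right (c : ℝ) (X Z : Matrix (Fin n) (Fin m) ℝ) :
    ipMat X (c • Z) = c * ipMat X Z := by
  simp [ipMat]

theorem ipMat_self_nonneg (X : Matrix (Fin n) (Fin m) ℝ) : 0 ≤ ipMat X X := by
  simp only [ipMat, Matrix.trace, Matrix.diag, Matrix.mul_apply, Matrix.transpose_apply]
  exact Finset.sum_nonneg fun i _ => Finset.sum_nonneg fun j _ => mul_self_nonneg _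

theorem ipMat_self_eq_zero {X : Matrix (Fin n) (Fin m) ℝ} : ipMat X X = 0 ↔ X = 0 :=
  Matrix.trace_conjTranspose_mul_self_eq_zero_iff (A := X)

theorem ipSym_comm (V W : SymMat n) : ipSym V W = ipSym W V := ipMat_comm _ _

/-- The trace inner product on symmetric matrices as a bilinear form. -/
def ipSymForm (n : ℕ) : LinearMap.BilinForm ℝ (SymMat n) :=
  LinearMap.mk₂ ℝ ipSym (fun _ _ _ => ipMat_add_left _ _ _) (fun _ _ _ => ipMat_smul_left _ _ _)
    (fun _ _ _ => ipMat_add_right _ _ _) (fun _ _ _ => ipMat_smul_right _ _ _)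

theorem ipSymForm_apply (V W : SymMat n) : ipSymForm n V W = ipSym V W := rfl

theorem ipSym_add_left (U V W : SymMat n) : ipSym (U + V) W = ipSym U W + ipSym V W :=
  ipMat_add_left _ _ _

theorem ipSym_add_right (U V W : SymMat n) : ipSym U (V + W) = ipSym U V + ipSym U W :=
  ipMat_add_right _ _ _

theorem ipSym_smul_left (c : ℝ) (V W : SymMat n) : ipSym (c • V) W = c * ipSym V W :=
  ipMat_smul_left _ _ _

theorem ipSym_smul_right (c : ℝ) (V W : SymMat n) : ipSym V (c • W) = c * ipSym V W :=
  ipMat_smul_right _ _ _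

theorem ipSym_neg_left (V W : SymMat n) : ipSym (-V) W = -ipSym V W := by
  rw [← ipSymForm_apply, map_neg]; rfl

theorem ipSym_neg_right (V W : SymMat n) : ipSym V (-W) = -ipSym V W := by
  rw [← ipSymForm_apply, map_neg]; rfl

theorem ipSym_sub_right (U V W : SymMat n) : ipSym U (V - W) = ipSym U V - ipSym U W := by
  rw [sub_eq_add_neg, ipSym_add_right, ipSym_neg_right, sub_eq_add_neg]

theorem ipSym_zero_right (V : SymMat n) : ipSym V 0 = 0 := map_zero (ipSymForm n V)

theorem ipSym_self_eq_zero {V : SymMat n} : ipSym V V = 0 ↔ V = 0 :=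
  ipMat_self_eq_zero.trans Submodule.coe_eq_zero

theorem ipSym_self_nonneg (V : SymMat n) : 0 ≤ ipSym V V := ipMat_self_nonneg _

theorem continuous_ipSym_left (V : SymMat n) : Continuous fun W => ipSym W V :=
  ((ipSymForm n).flip V).continuous_of_finiteDimensional

theorem continuous_ipSym_right (V : SymMat n) : Continuous fun W => ipSym V W :=
  (ipSymForm n V).continuous_of_finiteDimensional

/-- Every linear functional on symmetric matrices is an inner product. -/
theorem exists_ipSym_eq (f : SymMat n →ₗ[ℝ] ℝ) : ∃ V : SymMat n, ∀ W, f W = ipSym W V := by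
  have hinj : Function.Injective (ipSymForm n) := by
    refine (injective_iff_map_eq_zero _).2 fun V hV => ?_
    exact ipSym_self_eq_zero.1 (LinearMap.congr_fun hV V)
  obtain ⟨V, hV⟩ := (LinearMap.injective_iff_surjective_of_finrank_eq_finrank
    Subspace.dual_finrank_eq.symm).1 hinj f
  exact ⟨V, fun W => by rw [ipSym_comm, ← hV]; rfl⟩

/-- The topology is that of the entrywise sup norm; the norm stays local, as only the topology
matters. -/
instance locallyConvexSpace_symMat (n : ℕ) : LocallyConvexSpace ℝ (SymMat n) := by
  let : NormedAddCommGroup (Matrix (Fin n) (Fin n) ℝ) := Matrix.normedAddCommGroup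
  let : NormedSpace ℝ (Matrix (Fin n) (Fin n) ℝ) := Matrix.normedSpace
  exact NormedSpace.toLocallyConvexSpace (E := symSubmodule n)

/-- Strict separation of a point from a closed convex set of symmetric matrices. -/
theorem exists_separating {S : Set (SymMat n)} (hS : IsClosed S) (hconv : Convex ℝ S)
    {Z : SymMat n} (hZ : Z ∉ S) :
    ∃ (V : SymMat n) (s : ℝ), (∀ W ∈ S, ipSym W V ≤ s) ∧ s < ipSym Z V := by
  obtain ⟨f, s, hs, hlt⟩ := geometric_hahn_banach_closed_point hconv hS hZ
  obtain ⟨V, hV⟩ := exists_ipSym_eq f.toLinearMap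
  have hV' : ∀ W, f W = ipSym W V := hV
  exact ⟨V, s, fun W hW => hV' W ▸ (hs W hW).le, hV' Z ▸ hlt⟩

theorem isClosed_sub_symMat {C K : Set (SymMat n)} (hC : IsClosed C) (hK : IsClosed K)
    (hcone : ∀ c : ℝ, 0 < c → ∀ x ∈ K, c • x ∈ K)
    (hCK : horizonCone C ∩ K ⊆ {0}) : IsClosed (C - K) := by
  let : NormedAddCommGroup (Matrix (Fin n) (Fin n) ℝ) := Matrix.normedAddCommGroup
  let : NormedSpace ℝ (Matrix (Fin n) (Fin n) ℝ) := Matrix.normedSpace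
  exact isClosed_sub_of_horizonCone_inter (E := symSubmodule n) hC hK hcone hCK

theorem gaugeFn_le_one_iff_symMat {C : Set (SymMat n)} (hC : IsClosed C) (hconv : Convex ℝ C)
    (h0 : (0 : SymMat n) ∈ C) (x : SymMat n) : gaugeFn C x ≤ 1 ↔ x ∈ C := by
  let : NormedAddCommGroup (Matrix (Fin n) (Fin n) ℝ) := Matrix.normedAddCommGroup
  let : NormedSpace ℝ (Matrix (Fin n) (Fin n) ℝ) := Matrix.normedSpace
  exact gaugeFn_le_one_iff (E := symSubmodule n) hC hconv h0 x

/-- The domain of the conjugate of the support function of a closed convex set is the set. -/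
theorem dom_conj_supp {C : Set (SymMat n)} (hC : IsClosed C) (hconv : Convex ℝ C) :
    dom (conj ipSym (supp ipSym C)) = C := by
  ext W
  constructor
  · intro hW
    by_contra hWC
    obtain ⟨V, s, hs, hlt⟩ := exists_separating hC hconv hWC
    refine (ne_of_lt hW) (conj_eq_top fun r => ?_)
    have hd : 0 < ipSym W V - s := sub_pos.2 hlt
    -- At `t • V` the conjugate's objective is at least `t * (ipSym W V - s) = |r|`.
    set t := |r| / (ipSym W V - s) with ht
    have ht0 : 0 ≤ t := by positivity
    have htr : t * (ipSym W V - s) = |r| := div_mul_cancel₀ _ hd.ne'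
    refine ⟨t • V, supp_le_coe fun v hv => ?_⟩
    rw [ipSym_smul_right, ipSym_smul_left, ipSym_comm V W]
    nlinarith [mul_le_mul_of_nonneg_left (hs v hv) ht0, le_abs_self r]
  · intro hW
    refine (conj_nonpos fun V => ?_).trans_lt EReal.zero_lt_top
    rw [ipSym_comm]
    exact le_supp hW

end InnerProducts

end GMF

namespace GMF

/-! ### The cone `K_A` and its polar. -/

section MatrixCones

variable {l n m : ℕ} {A : Matrix (Fin l) (Fin n) ℝ}

theorem ipMat_mul_self_eq_sum (V : Matrix (Fin n) (Fin n) ℝ) (Y : Matrix (Fin n) (Fin m) ℝ) :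
    ipMat Y (V * Y) = ∑ j, (fun i => Y i j) ⬝ᵥ (V *ᵥ fun i => Y i j) := by
  simp only [ipMat, Matrix.trace, Matrix.diag, Matrix.mul_apply, Matrix.transpose_apply,
    dotProduct, Matrix.mulVec]

theorem ipMat_self_mul (V : Matrix (Fin n) (Fin n) ℝ) (Y : Matrix (Fin n) (Fin m) ℝ) :
    ipMat Y (V * Y) = ipMat (Y * Yᵀ) V := by
  rw [ipMat, ipMat, Matrix.transpose_mul, Matrix.transpose_transpose, Matrix.mul_assoc Y,
    Matrix.trace_mul_comm Y, Matrix.mul_assoc]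

theorem ipSym_halfGram_left (Y : Matrix (Fin n) (Fin m) ℝ) (V : SymMat n) :
    ipSym (halfGram Y) V = 1 / 2 * ipMat Y ((V : Matrix (Fin n) (Fin n) ℝ) * Y) := by
  rw [ipMat_self_mul, ← ipMat_smul_left]
  rfl

/-- The trace is the sum of the quadratic forms at the columns of `Y`, which lie in `ker A`. -/
theorem ipMat_mul_nonneg_of_mem_coneK {V : SymMat n} (hV : V ∈ coneK A)
    {Y : Matrix (Fin n) (Fin m) ℝ} (hY : A * Y = 0) :
    0 ≤ ipMat Y ((V : Matrix (Fin n) (Fin n) ℝ) * Y) := by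
  rw [ipMat_mul_self_eq_sum]
  refine Finset.sum_nonneg fun j _ => hV _ ?_
  ext i
  exact congrFun (congrFun hY i) j

theorem smul_mem_coneK {c : ℝ} (hc : 0 ≤ c) {V : SymMat n} (hV : V ∈ coneK A) :
    c • V ∈ coneK A := by
  intro u hu
  rw [Submodule.coe_smul, Matrix.smul_mulVec, dotProduct_smul]
  exact mul_nonneg hc (hV u hu)

theorem dotProduct_halfGram_mulVec (Y : Matrix (Fin n) (Fin m) ℝ) (u : Fin n → ℝ) :
    u ⬝ᵥ ((halfGram Y : Matrix (Fin n) (Fin n) ℝ) *ᵥ u) = 1 / 2 * (Yᵀ *ᵥ u ⬝ᵥ Yᵀ *ᵥ u) := by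
  change u ⬝ᵥ (((1 / 2 : ℝ) • (Y * Yᵀ)) *ᵥ u) = _
  rw [Matrix.smul_mulVec, dotProduct_smul, smul_eq_mul, ← Matrix.mulVec_mulVec,
    Matrix.dotProduct_mulVec, ← Matrix.mulVec_transpose]

theorem halfGram_mem_coneK (Y : Matrix (Fin n) (Fin m) ℝ) : halfGram Y ∈ coneK A := by
  intro u _
  rw [dotProduct_halfGram_mulVec]
  exact mul_nonneg (by norm_num) (Finset.sum_nonneg fun i _ => mul_self_nonneg _)

/-- The form of `AᵀA` vanishes on `ker A`, so its sign is immaterial there. Pairing with this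
element is what forces `A W = 0` for `W ∈ -K_A°`. -/
theorem neg_halfGram_transpose_mem_coneK : -halfGram Aᵀ ∈ coneK A := by
  intro u hu
  rw [Submodule.coe_neg, Matrix.neg_mulVec, dotProduct_neg, dotProduct_halfGram_mulVec,
    Matrix.transpose_transpose, hu]
  simp

theorem mem_polarSet_coneK {P : SymMat n} :
    P ∈ polarSet ipSym (coneK A) ↔ ∀ V ∈ coneK A, ipSym P V ≤ 0 := by
  refine ⟨fun hP V hV => ?_, fun h V hV => (h V hV).trans zero_le_one⟩
  by_contra! hpos
  -- The factor `2 / ⟨P, V⟩` would give `2 ≤ 1`.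
  have h := hP _ (smul_mem_coneK (div_pos two_pos hpos).le hV)
  rw [ipSym_smul_right, div_mul_cancel₀ _ hpos.ne'] at h
  norm_num at h

theorem mem_neg_polarSet_coneK {W : SymMat n} :
    W ∈ -polarSet ipSym (coneK A) ↔ ∀ V ∈ coneK A, 0 ≤ ipSym W V := by
  rw [Set.mem_neg, mem_polarSet_coneK]
  simp only [ipSym_neg_left, neg_nonpos]

theorem exists_eq_mul_transpose {W : Matrix (Fin n) (Fin n) ℝ} (hW : W.PosSemidef) :
    ∃ (k : ℕ) (B : Matrix (Fin n) (Fin k) ℝ), W = B * Bᵀ := by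
  obtain ⟨k, v, rfl⟩ := Matrix.posSemidef_iff_eq_sum_vecMulVec.1 hW
  refine ⟨k, Matrix.of fun i j => v j i, ?_⟩
  ext i j
  simp [Matrix.sum_apply, Matrix.vecMulVec_apply, Matrix.mul_apply]

/-- The negative polar of `K_A` consists of the positive semidefinite matrices with range in
`ker A`. -/
theorem mem_neg_polarSet_coneK_iff_posSemidef {W : SymMat n} :
    W ∈ -polarSet ipSym (coneK A) ↔
      A * (W : Matrix (Fin n) (Fin n) ℝ) = 0 ∧ (W : Matrix (Fin n) (Fin n) ℝ).PosSemidef := by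
  rw [mem_neg_polarSet_coneK]
  constructor
  · intro h
    have hpsd : (W : Matrix (Fin n) (Fin n) ℝ).PosSemidef := by
      refine Matrix.posSemidef_iff_dotProduct_mulVec.2 ⟨W.2, fun u => ?_⟩
      have := h _ (halfGram_mem_coneK (Matrix.of fun i (_ : Fin 1) => u i))
      rw [ipSym_comm, ipSym_halfGram_left, ipMat_mul_self_eq_sum] at this
      simp only [Finset.univ_unique, Finset.sum_singleton, Matrix.of_apply] at this
      change 0 ≤ u ⬝ᵥ _
      linarith
    refine ⟨?_, hpsd⟩
    -- This says `tr (A W Aᵀ) ≤ 0`; with `W = B Bᵀ` the trace is the squared norm of `Bᵀ Aᵀ`.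
    have hle := h _ neg_halfGram_transpose_mem_coneK
    rw [ipSym_neg_right, ipSym_comm, ipSym_halfGram_left] at hle
    obtain ⟨k, B, hB⟩ := exists_eq_mul_transpose hpsd
    have hnorm : ipMat Aᵀ ((W : Matrix (Fin n) (Fin n) ℝ) * Aᵀ) = ipMat (Bᵀ * Aᵀ) (Bᵀ * Aᵀ) := by
      rw [hB, ipMat, ipMat, Matrix.transpose_mul, Matrix.transpose_transpose,
        Matrix.transpose_transpose]
      simp only [Matrix.mul_assoc]
    have h0 : Bᵀ * Aᵀ = 0 := by
      refine ipMat_self_eq_zero.1 (le_antisymm ?_ (ipMat_self_nonneg _))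
      rw [← hnorm]
      linarith
    have hAB : A * B = 0 := by
      rw [← Matrix.transpose_mul] at h0
      exact Matrix.transpose_eq_zero.1 h0
    rw [hB, ← Matrix.mul_assoc, hAB, Matrix.zero_mul]
  · rintro ⟨hAW, hpsd⟩ V hV
    obtain ⟨k, B, hB⟩ := exists_eq_mul_transpose hpsd
    have hAB : A * B = 0 := by
      rw [hB] at hAW
      exact (Matrix.mul_self_mul_conjTranspose_eq_zero B A).1 hAW
    have h := ipMat_mul_nonneg_of_mem_coneK hV hAB
    rwa [ipMat_self_mul, ← hB] at h

theorem mul_halfGram_eq_zero_iff {Y : Matrix (Fin n) (Fin m) ℝ} :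
    A * (halfGram Y : Matrix (Fin n) (Fin n) ℝ) = 0 ↔ A * Y = 0 := by
  change A * ((1 / 2 : ℝ) • (Y * Yᵀ)) = 0 ↔ _
  rw [Matrix.mul_smul, smul_eq_zero_iff_right (by norm_num)]
  exact Matrix.mul_self_mul_conjTranspose_eq_zero Y A

theorem halfGram_mem_neg_polarSet_coneK_iff {Y : Matrix (Fin n) (Fin m) ℝ} :
    halfGram Y ∈ -polarSet ipSym (coneK A) ↔ A * Y = 0 := by
  refine ⟨fun h => mul_halfGram_eq_zero_iff.1 (mem_neg_polarSet_coneK_iff_posSemidef.1 h).1,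
    fun h => mem_neg_polarSet_coneK.2 fun V hV => ?_⟩
  rw [ipSym_halfGram_left]
  exact mul_nonneg (by norm_num) (ipMat_mul_nonneg_of_mem_coneK hV h)

/-- Bipolarity without separation: the elements `-½ u uᵀ` of the polar, `u ∈ ker A`, already cut out
`K_A`. -/
theorem mem_coneK_of_forall_polarSet {V : SymMat n}
    (hV : ∀ P ∈ polarSet ipSym (coneK A), ipSym P V ≤ 0) : V ∈ coneK A := by
  intro u hu
  have hAu : A * (Matrix.of fun i (_ : Fin 1) => u i) = 0 := by
    ext i j
    exact congrFun hu i
  have h := hV _ (halfGram_mem_neg_polarSet_coneK_iff.2 hAu)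
  rw [ipSym_neg_left, ipSym_halfGram_left, ipMat_mul_self_eq_sum] at h
  simp only [Finset.univ_unique, Finset.sum_singleton, Matrix.of_apply] at h
  linarith

theorem smul_mem_polarSet_coneK {c : ℝ} (hc : 0 ≤ c) {P : SymMat n}
    (hP : P ∈ polarSet ipSym (coneK A)) : c • P ∈ polarSet ipSym (coneK A) := by
  rw [mem_polarSet_coneK] at hP ⊢
  intro V hV
  rw [ipSym_smul_left]
  exact mul_nonpos_of_nonneg_of_nonpos hc (hP V hV)

theorem convex_polarSet_coneK : Convex ℝ (polarSet ipSym (coneK A)) := by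
  intro P hP Q hQ a b ha hb _
  rw [mem_polarSet_coneK] at hP hQ ⊢
  intro V hV
  rw [ipSym_add_left, ipSym_smul_left, ipSym_smul_left]
  nlinarith [mul_nonneg ha (neg_nonneg.2 (hP V hV)), mul_nonneg hb (neg_nonneg.2 (hQ V hV))]

theorem isClosed_polarSet_coneK : IsClosed (polarSet ipSym (coneK A)) := by
  simp only [polarSet, Set.ofPred_forall]
  exact isClosed_biInter fun V _ => isClosed_le (continuous_ipSym_left V) continuous_const

end MatrixCones

/-! ### Constraint qualifications -/

section ConstraintQualification

variable {l n : ℕ} {A : Matrix (Fin l) (Fin n) ℝ} {C : Set (SymMat n)}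

theorem ipSym_nonpos_of_mem_horizonCone {W V : SymMat n} (hW : W ∈ horizonCone C)
    (hV : V ∈ bar C) : ipSym W V ≤ 0 := by
  obtain ⟨c, x, hc, hc0, hx, hlim⟩ := hW
  obtain ⟨s, hs⟩ := supp_lt_top_iff.1 hV
  have h1 : Tendsto (fun k => ipSym (c k • x k) V) atTop (𝓝 (ipSym W V)) :=
    (continuous_ipSym_left V).continuousAt.tendsto.comp hlim
  have h2 : Tendsto (fun k => c k * s) atTop (𝓝 0) := by simpa using hc0.mul_const s
  refine le_of_tendsto_of_tendsto' h1 h2 fun k => ?_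
  rw [ipSym_smul_left]
  exact mul_le_mul_of_nonneg_left (hs _ (hx k)) (hc k).le

theorem horizonCone_inter_of_bar_inter_interior
    (h : (bar C ∩ interior (coneK A)).Nonempty) :
    horizonCone C ∩ -polarSet ipSym (coneK A) ⊆ {0} := by
  rintro W ⟨hWC, hWK⟩
  obtain ⟨V, hVC, hVK⟩ := h
  have hcont : Tendsto (fun ε : ℝ => V - ε • W) (𝓝[>] 0) (𝓝 V) := by
    have h0 : Continuous fun ε : ℝ => V - ε • W := by fun_prop
    simpa using (h0.tendsto 0).mono_left (nhdsWithin_le_nhds (s := Ioi (0 : ℝ)))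
  -- Interiority gives `V - ε W ∈ K_A`, so `0 ≤ ⟨W, V⟩ - ε ‖W‖²` while `⟨W, V⟩ ≤ 0`.
  obtain ⟨ε, hε, hε0⟩ := ((hcont.eventually_mem (mem_interior_iff_mem_nhds.1 hVK)).and
    eventually_mem_nhdsWithin).exists
  have h1 := mem_neg_polarSet_coneK.1 hWK _ hε
  have h2 := ipSym_nonpos_of_mem_horizonCone hWC hVC
  rw [ipSym_sub_right, ipSym_smul_right] at h1
  have h3 : ε * ipSym W W ≤ 0 := by linarith
  exact ipSym_self_eq_zero.1
    (le_antisymm (nonpos_of_mul_nonpos_right h3 hε0) (ipSym_self_nonneg W))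

theorem horizonCone_inter_of_closure_sub_eq_univ (h : closure (bar C) - coneK A = univ) :
    horizonCone C ∩ -polarSet ipSym (coneK A) ⊆ {0} := by
  rintro W ⟨hWC, hWK⟩
  -- Decomposing `W` itself gives `‖W‖² = ⟨W, V⟩ - ⟨W, U⟩ ≤ 0`.
  obtain ⟨V, hV, U, hU, hVU⟩ := Set.mem_sub.1 (h ▸ mem_univ W : W ∈ closure (bar C) - coneK A)
  have h1 : ipSym W V ≤ 0 := closure_minimal (t := {V | ipSym W V ≤ 0})
    (fun V hV => ipSym_nonpos_of_mem_horizonCone hWC hV)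
    (isClosed_le (continuous_ipSym_right W) continuous_const) hV
  have h2 := mem_neg_polarSet_coneK.1 hWK U hU
  have h3 : ipSym W W = ipSym W V - ipSym W U := by rw [← ipSym_sub_right, hVU]
  exact ipSym_self_eq_zero.1 (le_antisymm (by linarith) (ipSym_self_nonneg W))

/-- Under any of the constraint qualifications, `C + K_A°` is closed. -/
theorem isClosed_add_polarSet_coneK (hC : IsClosed C)
    (hCQ : CCQ A (supp ipSym C) ∨ (bar C ∩ interior (coneK A)).Nonempty ∨
      horizonCone C ∩ -polarSet ipSym (coneK A) = {0} ∨ closure (bar C) - coneK A = univ) :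
    IsClosed (C + polarSet ipSym (coneK A)) := by
  have hhor : horizonCone C ∩ -polarSet ipSym (coneK A) ⊆ {0} := by
    rcases hCQ with h | h | h | h
    · exact horizonCone_inter_of_bar_inter_interior
        (h.mono (inter_subset_inter_left _ intrinsicInterior_subset))
    · exact horizonCone_inter_of_bar_inter_interior h
    · exact h.subset
    · exact horizonCone_inter_of_closure_sub_eq_univ h
  have h := isClosed_sub_symMat hC (isClosed_polarSet_coneK (A := A)).neg
    (fun c hc W hW => by
      have h := smul_mem_polarSet_coneK hc.le (Set.mem_neg.1 hW)
      rwa [(smul_neg c W : c • -W = -(c • W)), ← Set.mem_neg] at h) hhor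
  rwa [sub_neg_eq_add] at h

end ConstraintQualification

/-! ### The conjugate of the infimal projection -/

section Conjugate

variable {l n m : ℕ} {A : Matrix (Fin l) (Fin n) ℝ} {C : Set (SymMat n)}

theorem ipProd_graphD (Z X : Matrix (Fin n) (Fin m) ℝ) (V : SymMat n) :
    ipProd (Z, -halfGram Z) (X, V) =
      ipMat Z X - 1 / 2 * ipMat Z ((V : Matrix (Fin n) (Fin n) ℝ) * Z) := by
  rw [ipProd, ipSym_neg_left, ipSym_halfGram_left, sub_eq_add_neg]

theorem le_phi {Z : Matrix (Fin n) (Fin m) ℝ} (hZ : A * Z = 0) (X : Matrix (Fin n) (Fin m) ℝ)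
    (V : SymMat n) :
    ((ipMat Z X - 1 / 2 * ipMat Z ((V : Matrix (Fin n) (Fin n) ℝ) * Z) : ℝ) : EReal) ≤
      phi A (0 : Matrix (Fin l) (Fin m) ℝ) (X, V) := by
  rw [← ipProd_graphD]
  exact le_supp ⟨hZ, rfl⟩

theorem phi_le_coe {X : Matrix (Fin n) (Fin m) ℝ} {V : SymMat n} {s : ℝ}
    (h : ∀ Z : Matrix (Fin n) (Fin m) ℝ, A * Z = 0 →
      ipMat Z X - 1 / 2 * ipMat Z ((V : Matrix (Fin n) (Fin n) ℝ) * Z) ≤ s) :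
    phi A (0 : Matrix (Fin l) (Fin m) ℝ) (X, V) ≤ (s : EReal) := by
  refine supp_le_coe ?_
  rintro ⟨Z, W⟩ ⟨hZ, hW⟩
  obtain rfl : W = -halfGram Z := hW
  rw [ipProd_graphD]
  exact h Z hZ

/-- A direction of negative curvature in `ker A`, repeated in every column, makes the quadratic term
beat the linear one. With `m = 0` there would be no column to hold it. -/
theorem phi_eq_top (hm : 0 < m) {V : SymMat n} (hV : V ∉ coneK A)
    (X : Matrix (Fin n) (Fin m) ℝ) : phi A (0 : Matrix (Fin l) (Fin m) ℝ) (X, V) = ⊤ := by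
  simp only [coneK, mem_ofPred_eq, not_forall, not_le] at hV
  obtain ⟨u, hu, hneg⟩ := hV
  set q := u ⬝ᵥ ((V : Matrix (Fin n) (Fin n) ℝ) *ᵥ u)
  set Z : Matrix (Fin n) (Fin m) ℝ := Matrix.of fun i _ => u i with hZdef
  have hZ : A * Z = 0 := by
    ext i j
    exact congrFun hu i
  have hq : ipMat Z ((V : Matrix (Fin n) (Fin n) ℝ) * Z) < 0 := by
    rw [ipMat_mul_self_eq_sum]
    refine Finset.sum_neg (fun j _ => hneg) ⟨⟨0, hm⟩, Finset.mem_univ _⟩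
  refine EReal.eq_top_iff_forall_lt _ |>.2 fun r => ?_
  set a := -(1 / 2 * ipMat Z ((V : Matrix (Fin n) (Fin n) ℝ) * Z)) with ha
  set b := ipMat Z X
  have ha0 : 0 < a := by rw [ha]; linarith
  set t := 1 + (|b| + |r|) / a with ht
  have ht1 : 1 ≤ t := by
    have : 0 ≤ (|b| + |r|) / a := by positivity
    linarith
  have hta : t * a = a + (|b| + |r|) := by rw [ht]; field_simp
  refine lt_of_lt_of_le ?_ (le_phi (Z := t • Z) (by rw [Matrix.mul_smul, hZ, smul_zero]) X V)
  rw [Matrix.mul_smul, ipMat_smul_left, ipMat_smul_left, ipMat_smul_right]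
  have hval : t * b - 1 / 2 * (t * (t * ipMat Z ((V : Matrix (Fin n) (Fin n) ℝ) * Z))) =
      t * (b + t * a) := by rw [ha]; ring
  rw [hval, hta]
  have h1 : |r| < b + (a + (|b| + |r|)) := by linarith [neg_abs_le b]
  have h2 : b + (a + (|b| + |r|)) ≤ t * (b + (a + (|b| + |r|))) :=
    le_mul_of_one_le_left ((abs_nonneg r).trans h1.le) ht1
  exact_mod_cast (le_abs_self r).trans_lt (h1.trans_le h2)

theorem infProj_le_coe {h : SymMat n → EReal} {X : Matrix (Fin n) (Fin m) ℝ} {V : SymMat n}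
    {a s r : ℝ} (ha : phi A (0 : Matrix (Fin l) (Fin m) ℝ) (X, V) ≤ (a : EReal))
    (hs : h V ≤ (s : EReal)) (hr : a + s ≤ r) :
    infProj A (0 : Matrix (Fin l) (Fin m) ℝ) h X ≤ (r : EReal) :=
  (iInf_le _ V).trans ((add_le_add ha hs).trans (by exact_mod_cast hr))

theorem supp_zero_le : supp ipSym C 0 ≤ ((0 : ℝ) : EReal) :=
  supp_le_coe fun v _ => (ipSym_zero_right v).le

theorem conj_infProj_nonneg (Y : Matrix (Fin n) (Fin m) ℝ) :
    0 ≤ conj ipMat (infProj A (0 : Matrix (Fin l) (Fin m) ℝ) (supp ipSym C)) Y := by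
  have h0 : infProj A (0 : Matrix (Fin l) (Fin m) ℝ) (supp ipSym C) 0 ≤ ((0 : ℝ) : EReal) :=
    infProj_le_coe (V := 0) (a := 0) (phi_le_coe fun Z _ => by simp [ipMat]) supp_zero_le
      (by norm_num)
  refine le_trans ?_
    (le_iSup (fun X => ((ipMat X Y : ℝ) : EReal) - infProj A 0 (supp ipSym C) X) 0)
  refine le_trans ?_ (EReal.sub_le_sub le_rfl h0)
  simp [ipMat]

theorem conj_infProj_nonpos (hm : 0 < m) {Y : Matrix (Fin n) (Fin m) ℝ} (hY : A * Y = 0)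
    (hmem : halfGram Y ∈ C + polarSet ipSym (coneK A)) :
    conj ipMat (infProj A (0 : Matrix (Fin l) (Fin m) ℝ) (supp ipSym C)) Y ≤ 0 := by
  obtain ⟨W, hW, P, hP, hWP⟩ := Set.mem_add.1 hmem
  refine conj_nonpos fun X => le_iInf fun V => ?_
  have hsupp : ((ipSym W V : ℝ) : EReal) ≤ supp ipSym C V := le_supp hW
  by_cases hV : V ∈ coneK A
  · refine le_trans ?_ (add_le_add (le_phi hY X V) hsupp)
    rw [← ipSym_halfGram_left, ← hWP, ipSym_add_left, ipMat_comm X]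
    have := mem_polarSet_coneK.1 hP V hV
    exact_mod_cast (by linarith :
      ipMat Y X ≤ ipMat Y X - (ipSym W V + ipSym P V) + ipSym W V)
  -- In `EReal`, `⊤ + ⊥ = ⊥`; the point `W ∈ C` keeps `σ_C V` above `⊥`.
  · rw [phi_eq_top hm hV, EReal.top_add_of_ne_bot]
    · exact le_top
    · exact ((EReal.bot_lt_coe _).trans_le hsupp).ne'

/-- `Aᵀ A Y` is orthogonal to every `Z` with `A Z = 0`, so `φ` is at most `0` at its multiples with
`V = 0`, yet it pairs with `Y` to `‖A Y‖² > 0`. -/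
theorem conj_infProj_eq_top_of_mul_ne_zero {Y : Matrix (Fin n) (Fin m) ℝ} (hY : A * Y ≠ 0) :
    conj ipMat (infProj A (0 : Matrix (Fin l) (Fin m) ℝ) (supp ipSym C)) Y = ⊤ := by
  have hadj : ∀ Z : Matrix (Fin n) (Fin m) ℝ,
      ipMat (Aᵀ * (A * Y)) Z = ipMat (A * Y) (A * Z) := fun Z => by
    rw [ipMat, ipMat, Matrix.transpose_mul, Matrix.transpose_transpose, Matrix.mul_assoc]
  have hd : ipMat (A * Y) (A * Y) ≠ 0 := fun h => hY (ipMat_self_eq_zero.1 h)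
  refine conj_eq_top fun r => ⟨(r / ipMat (A * Y) (A * Y)) • (Aᵀ * (A * Y)), ?_⟩
  refine infProj_le_coe (V := 0) (a := 0) (phi_le_coe fun Z hZ => ?_) supp_zero_le ?_
  · rw [ipMat_smul_right, ipMat_comm Z, hadj, hZ]
    simp [ipMat]
  · rw [ipMat_smul_left, hadj, div_mul_cancel₀ _ hd]
    simp

/-- On the graph of multiplication by `V ∈ K_A` the matrix-fractional function is quadratic. -/
theorem phi_mul_le {V : SymMat n} (hV : V ∈ coneK A) {Y : Matrix (Fin n) (Fin m) ℝ}
    (hY : A * Y = 0) :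
    phi A (0 : Matrix (Fin l) (Fin m) ℝ) ((V : Matrix (Fin n) (Fin n) ℝ) * Y, V) ≤
      ((1 / 2 * ipMat Y ((V : Matrix (Fin n) (Fin n) ℝ) * Y) : ℝ) : EReal) := by
  refine phi_le_coe fun Z hZ => ?_
  -- Completing the square: expand `⟨Z - Y, V (Z - Y)⟩ ≥ 0`.
  have h := ipMat_mul_nonneg_of_mem_coneK hV (Y := Z + (-1 : ℝ) • Y)
    (by rw [Matrix.mul_add, Matrix.mul_smul, hZ, hY, smul_zero, add_zero])
  have hsymm : ipMat Y ((V : Matrix (Fin n) (Fin n) ℝ) * Z) =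
      ipMat Z ((V : Matrix (Fin n) (Fin n) ℝ) * Y) := by
    rw [ipMat_comm, ipMat, ipMat, Matrix.transpose_mul, V.2.eq, Matrix.mul_assoc]
  simp only [Matrix.mul_add, Matrix.mul_smul, ipMat_add_left, ipMat_add_right, ipMat_smul_left,
    ipMat_smul_right, hsymm] at h
  linarith

theorem conj_infProj_eq_top_of_notMem (hne : C.Nonempty) (hconv : Convex ℝ C)
    (hclosed : IsClosed (C + polarSet ipSym (coneK A)))
    {Y : Matrix (Fin n) (Fin m) ℝ} (hY : A * Y = 0)
    (hmem : halfGram Y ∉ C + polarSet ipSym (coneK A)) :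
    conj ipMat (infProj A (0 : Matrix (Fin l) (Fin m) ℝ) (supp ipSym C)) Y = ⊤ := by
  obtain ⟨V, s, hs, hlt⟩ := exists_separating hclosed (hconv.add convex_polarSet_coneK) hmem
  have hsC : ∀ W ∈ C, ipSym W V ≤ s := fun W hW => by
    have h0 : (0 : SymMat n) ∈ polarSet ipSym (coneK A) :=
      mem_polarSet_coneK.2 fun U _ => by rw [ipSym_comm, ipSym_zero_right]
    simpa using hs _ (Set.add_mem_add hW h0)
  -- A functional bounded above on `C + K_A°` cannot be positive on the cone `K_A°`.
  have hVK : V ∈ coneK A := by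
    refine mem_coneK_of_forall_polarSet fun P hP => ?_
    obtain ⟨W, hW⟩ := hne
    by_contra! hpos
    set c := (|s - ipSym W V| + 1) / ipSym P V with hc
    have hcP : c * ipSym P V = |s - ipSym W V| + 1 := div_mul_cancel₀ _ hpos.ne'
    have h := hs _ (Set.add_mem_add hW (smul_mem_polarSet_coneK (c := c) (by positivity) hP))
    rw [ipSym_add_left, ipSym_smul_left, hcP] at h
    linarith [le_abs_self (s - ipSym W V)]
  refine conj_eq_top fun r => ?_
  have hd : 0 < ipSym (halfGram Y) V - s := sub_pos.2 hlt
  set t := |r| / (ipSym (halfGram Y) V - s) with ht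
  have ht0 : 0 ≤ t := by positivity
  have htr : t * (ipSym (halfGram Y) V - s) = |r| := div_mul_cancel₀ _ hd.ne'
  -- At `X = t V Y` and `t V`, half of `⟨X, Y⟩` pays for `φ`; what remains is at least `t (⟨½ Y Yᵀ,
  -- V⟩ - s) = |r|`.
  refine ⟨((t • V : SymMat n) : Matrix (Fin n) (Fin n) ℝ) * Y,
    infProj_le_coe (phi_mul_le (smul_mem_coneK ht0 hVK) hY) (s := t * s)
      (supp_le_coe fun W hW => ?_) ?_⟩
  · rw [ipSym_smul_right]
    exact mul_le_mul_of_nonneg_left (hsC W hW) ht0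
  · rw [← ipSym_halfGram_left, ipMat_comm _ Y]
    have h2 := ipSym_halfGram_left Y (t • V)
    rw [ipSym_smul_right] at h2 ⊢
    nlinarith [le_abs_self r]

theorem mem_Xi_iff (hC : IsClosed C) (hconv : Convex ℝ C) {Y : Matrix (Fin n) (Fin m) ℝ} :
    Y ∈ Xi A (0 : Matrix (Fin l) (Fin m) ℝ) (supp ipSym C) ↔
      A * Y = 0 ∧ halfGram Y ∈ C + polarSet ipSym (coneK A) := by
  rw [Xi, dom_conj_supp hC hconv]
  rfl

/-- The conjugate of the infimal projection is the indicator of `Ξ(A,0)`. -/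
theorem conj_infProj_eq_indic_Xi (hm : 0 < m) (hne : C.Nonempty) (hC : IsClosed C)
    (hconv : Convex ℝ C) (hclosed : IsClosed (C + polarSet ipSym (coneK A))) :
    conj ipMat (infProj A (0 : Matrix (Fin l) (Fin m) ℝ) (supp ipSym C)) =
      indic (Xi A (0 : Matrix (Fin l) (Fin m) ℝ) (supp ipSym C)) := by
  funext Y
  by_cases hY : Y ∈ Xi A (0 : Matrix (Fin l) (Fin m) ℝ) (supp ipSym C)
  · rw [indic, if_pos hY]
    rw [mem_Xi_iff hC hconv] at hY
    exact le_antisymm (conj_infProj_nonpos hm hY.1 hY.2) (conj_infProj_nonneg Y)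
  · rw [indic, if_neg hY]
    rw [mem_Xi_iff hC hconv, not_and] at hY
    by_cases hAY : A * Y = 0
    · exact conj_infProj_eq_top_of_notMem hne hconv hclosed hAY (hY hAY)
    · exact conj_infProj_eq_top_of_mul_ne_zero hAY

theorem halfGram_mem_add_polarSet_iff {Y : Matrix (Fin n) (Fin m) ℝ} :
    halfGram Y ∈ C + polarSet ipSym (coneK A) ↔
      ∃ W ∈ C, W - halfGram Y ∈ -polarSet ipSym (coneK A) := by
  constructor
  · intro h
    obtain ⟨W, hW, P, hP, hWP⟩ := Set.mem_add.1 h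
    refine ⟨W, hW, ?_⟩
    rwa [Set.mem_neg, neg_sub, ← hWP, add_sub_cancel_left]
  · rintro ⟨W, hW, hP⟩
    rw [Set.mem_neg, neg_sub] at hP
    exact Set.mem_add.2 ⟨W, hW, _, hP, add_sub_cancel _ _⟩

theorem Xi_eq_setOf_posSemidef (hC : IsClosed C) (hconv : Convex ℝ C) :
    Xi A (0 : Matrix (Fin l) (Fin m) ℝ) (supp ipSym C) =
      {Y : Matrix (Fin n) (Fin m) ℝ | A * Y = 0 ∧
        ∃ W ∈ C, A * (W : Matrix (Fin n) (Fin n) ℝ) = 0 ∧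
          ((W : Matrix (Fin n) (Fin n) ℝ) - (1 / 2 : ℝ) • (Y * Yᵀ)).PosSemidef} := by
  ext Y
  rw [mem_Xi_iff hC hconv, mem_ofPred_eq, halfGram_mem_add_polarSet_iff]
  refine and_congr_right fun hY => exists_congr fun W => and_congr_right fun _ => ?_
  rw [mem_neg_polarSet_coneK_iff_posSemidef, Submodule.coe_sub, Matrix.mul_sub,
    mul_halfGram_eq_zero_iff.2 hY, sub_zero]
  rfl

/-- Under a compatible gauge, membership in `Ξ(A,0)` means that `½ Y Yᵀ` lies in `C`. -/
theorem mem_Xi_iff_of_coneCompatible (hC : IsClosed C) (hconv : Convex ℝ C)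
    (h0 : (0 : SymMat n) ∈ C)
    (hcompat : ConeCompatible (-polarSet ipSym (coneK A)) (gaugeFn C))
    {Y : Matrix (Fin n) (Fin m) ℝ} :
    Y ∈ Xi A (0 : Matrix (Fin l) (Fin m) ℝ) (supp ipSym C) ↔ A * Y = 0 ∧ halfGram Y ∈ C := by
  rw [mem_Xi_iff hC hconv, halfGram_mem_add_polarSet_iff]
  refine and_congr_right fun hY => ⟨?_, fun h => ⟨_, h, ?_⟩⟩
  · rintro ⟨W, hW, hWY⟩
    rw [← gaugeFn_le_one_iff_symMat hC hconv h0] at hW ⊢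
    -- Monotonicity of the gauge along `0 ⪯ ½ Y Yᵀ ⪯ W` in the order of `-K_A°`.
    refine (hcompat _ _ ?_ hWY).trans hW
    rw [ConeLE, sub_zero]
    exact halfGram_mem_neg_polarSet_coneK_iff.2 hY
  · rw [sub_self]
    exact mem_neg_polarSet_coneK.2 fun V _ => by rw [ipSym_comm, ipSym_zero_right]

end Conjugate

end GMF

theorem mainTheorem12 {l n m : ℕ} (hm : 0 < m) (A : Matrix (Fin l) (Fin n) ℝ)
    (C : Set (GMF.SymMat n)) (hne : C.Nonempty) (hclosed : IsClosed C) (hconv : Convex ℝ C)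
    (hCQ : GMF.CCQ A (GMF.supp GMF.ipSym C) ∨
      (GMF.bar C ∩ interior (GMF.coneK A)).Nonempty ∨
      GMF.horizonCone C ∩ -GMF.polarSet GMF.ipSym (GMF.coneK A) = {0} ∨
      closure (GMF.bar C) - GMF.coneK A = Set.univ) :
    (GMF.conj GMF.ipMat
        (GMF.infProj A (0 : Matrix (Fin l) (Fin m) ℝ) (GMF.supp GMF.ipSym C)) =
        GMF.indic (GMF.Xi A (0 : Matrix (Fin l) (Fin m) ℝ) (GMF.supp GMF.ipSym C)) ∧
      GMF.Xi A (0 : Matrix (Fin l) (Fin m) ℝ) (GMF.supp GMF.ipSym C) =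
        {Y : Matrix (Fin n) (Fin m) ℝ | A * Y = 0 ∧
          ∃ W ∈ C, A * (W : Matrix (Fin n) (Fin n) ℝ) = 0 ∧
            ((W : Matrix (Fin n) (Fin n) ℝ) - (1 / 2 : ℝ) • (Y * Yᵀ)).PosSemidef}) ∧
    ((0 : GMF.SymMat n) ∈ C →
      GMF.ConeCompatible (-GMF.polarSet GMF.ipSym (GMF.coneK A)) (GMF.gaugeFn C) →
      ∀ Y : Matrix (Fin n) (Fin m) ℝ,
        GMF.conj GMF.ipMat
            (GMF.infProj A (0 : Matrix (Fin l) (Fin m) ℝ) (GMF.supp GMF.ipSym C)) Y =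
          GMF.indic {Z : Matrix (Fin n) (Fin m) ℝ |
            A * Z = 0 ∧ GMF.gaugeFn C (GMF.halfGram Z) ≤ 1} Y ∧
        GMF.conj GMF.ipMat
            (GMF.infProj A (0 : Matrix (Fin l) (Fin m) ℝ) (GMF.supp GMF.ipSym C)) Y =
          GMF.indic (-GMF.polarSet GMF.ipSym (GMF.coneK A) ∩ C) (GMF.halfGram Y)) := by
  have hXi := GMF.conj_infProj_eq_indic_Xi (m := m) hm hne hclosed hconv
    (GMF.isClosed_add_polarSet_coneK hclosed hCQ)
  refine ⟨⟨hXi, GMF.Xi_eq_setOf_posSemidef hclosed hconv⟩, fun h0 hcompat Y => ?_⟩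
  have hY := GMF.mem_Xi_iff_of_coneCompatible hclosed hconv h0 hcompat (Y := Y)
  rw [hXi]
  refine ⟨GMF.indic_congr ?_, GMF.indic_congr ?_⟩
  · rw [hY, ← GMF.gaugeFn_le_one_iff_symMat hclosed hconv h0]
    rfl
  · rw [hY, Set.mem_inter_iff, GMF.halfGram_mem_neg_polarSet_coneK_iff]
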